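/- All graphs are finite, undirected and loopless; parallel edges are allowed. For an integer $\ell \ge 0$, an $\ell$-arc of a graph $G$ is an alternating sequence $(v_0, e_1, v_1, \ldots, e_\ell, v_\ell)$ of vertices and edges of $G$ such that $e_i$ has end vertices $v_{i-1}$ and $v_i$ for $1 \le i \le \ell$, and $e_i \ne e_{i+1}$ for $1 \le i < \ell$. An $\ell$-link $[v_0, e_1, \ldots, e_\ell, v_\ell]$ is an $\ell$-arc identified with its reverse $(v_\ell, e_\ell, \ldots, e_1, v_0)$. The $\ell$-link graph $\mathbb{L}_\ell(G)$ is the graph whose vertices are the $\ell$-links of $G$ and whose edges are the $(\ell+1)$-links of $G$, where the $(\ell+1)$-link $[v_0, e_1, \ldots, e_{\ell+1}, v_{\ell+1}]$ joins the $\ell$-links $[v_0, e_1, \ldots, e_\ell, v_\ell]$ and $[v_1, e_2, \ldots, e_{\ell+1}, v_{\ell+1}]$. A graph contains a $K_t$-minor if a graph isomorphic to the complete graph $K_t$ can be obtained from one of its subgraphs by contracting edges (identifying the end vertices of an edge and deleting the resulting loops). The Hadwiger number $\eta(G)$ is the maximum $t$ such that $G$ contains a $K_t$-minor. The degeneracy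 of $G$ is the maximum, over the subgraphs $H$ of $G$ with at least one vertex, of the minimum degree of $H$, where parallel edges are counted separately in degrees. **Theorem.** Let $\ell \ge 1$ be an integer, and let $G$ be a graph such that $\mathbb{L}_\ell(G)$ contains at least one edge. Then $$\eta(\mathbb{L}_\ell(G)) \ge \max\{\eta(G), \mathrm{degeneracy}(G)\}.$$ -/

import Mathlib

open scoped Graph

namespace LinkGraphs

/-! Multigraphs are terms `G : Graph α β` of Mathlib: `V(G)` is the vertex set, `E(G)` the edge set,
and `G.IsLink e x y` says that `e` is an edge of `G` with end vertices `x` and `y`. Parallel edges are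
allowed. Subgraphs are given by the order `≤` on `Graph α β`. -/

/-! ### Arcs, links and link graphs -/

/-- An alternating sequence `(v₀, e₁, v₁, …, e_ℓ, v_ℓ)`; `vert i` is `v_i`, and `edge i` is the
symbol `e_{i+1}` that stands between `v_i` and `v_{i+1}`. -/
@[ext]
structure AltSeq (α β : Type*) (ℓ : ℕ) where
  vert : Fin (ℓ + 1) → α
  edge : Fin ℓ → β

namespace AltSeq

variable {α β : Type*} {ℓ : ℕ}

/-- The reverse sequence `(v_ℓ, e_ℓ, …, e₁, v₀)`. -/
def reverse (A : AltSeq α β ℓ) : AltSeq α β ℓ where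
  vert i := A.vert i.rev
  edge i := A.edge i.rev

/-- The segment `A(0, ℓ)` of a sequence of length `ℓ + 1`. -/
def init (A : AltSeq α β (ℓ + 1)) : AltSeq α β ℓ where
  vert i := A.vert i.castSucc
  edge i := A.edge i.castSucc

/-- The segment `A(1, ℓ + 1)` of a sequence of length `ℓ + 1`. -/
def tail (A : AltSeq α β (ℓ + 1)) : AltSeq α β ℓ where
  vert i := A.vert i.succ
  edge i := A.edge i.succ

theorem reverse_reverse (A : AltSeq α β ℓ) : A.reverse.reverse = A := by
  ext i <;> simp [reverse]

theorem reverse_init (A : AltSeq α β (ℓ + 1)) : A.init.reverse = A.reverse.tail := by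
  ext i <;> simp [reverse, init, tail, Fin.rev_succ]

theorem reverse_tail (A : AltSeq α β (ℓ + 1)) : A.tail.reverse = A.reverse.init := by
  ext i <;> simp [reverse, init, tail, Fin.rev_castSucc]

/-- A sequence is identified with its reverse. -/
instance reverseSetoid (α β : Type*) (ℓ : ℕ) : Setoid (AltSeq α β ℓ) where
  r A B := B = A ∨ B = A.reverse
  iseqv :=
    { refl := fun _ => Or.inl rfl
      symm := by
        rintro A B (rfl | rfl)
        · exact Or.inl rfl
        · exact Or.inr (reverse_reverse A).symm
      trans := by
        rintro A B C (rfl | rfl) (rfl | rfl)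
        · exact Or.inl rfl
        · exact Or.inr rfl
        · exact Or.inr rfl
        · exact Or.inl (reverse_reverse A) }

end AltSeq

/-- `A = (v₀, e₁, …, e_ℓ, v_ℓ)` is an `ℓ`-arc of `G`: the `v_i` are vertices of `G`, each `e_{i+1}`
is an edge of `G` with end vertices `v_i` and `v_{i+1}`, and consecutive edges are different. -/
structure IsArc {α β : Type*} (G : Graph α β) {ℓ : ℕ} (A : AltSeq α β ℓ) : Prop where
  vert_mem : ∀ i, A.vert i ∈ V(G)
  isLink : ∀ i : Fin ℓ, G.IsLink (A.edge i) (A.vert i.castSucc) (A.vert i.succ)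
  edge_ne : ∀ i j : Fin ℓ, (i : ℕ) + 1 = j → A.edge i ≠ A.edge j

/-- Alternating sequences of length `ℓ` up to reversal. -/
abbrev UnorientedSeq (α β : Type*) (ℓ : ℕ) : Type _ := Quotient (AltSeq.reverseSetoid α β ℓ)

section

variable {α β : Type*} {ℓ : ℕ}

/-- The object `[v₀, e₁, …, e_ℓ, v_ℓ]` obtained from a sequence by forgetting its orientation. -/
def unorient (A : AltSeq α β ℓ) : UnorientedSeq α β ℓ := Quotient.mk _ A

theorem unorient_eq_iff {A B : AltSeq α β ℓ} : unorient A = unorient B ↔ B = A ∨ B = A.reverse :=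
  Quotient.eq

theorem unorient_reverse (A : AltSeq α β ℓ) : unorient A.reverse = unorient A :=
  (unorient_eq_iff.2 (Or.inr rfl)).symm

theorem IsArc.reverse {G : Graph α β} {A : AltSeq α β ℓ} (h : IsArc G A) : IsArc G A.reverse where
  vert_mem i := h.vert_mem _
  isLink i := by
    have := (h.isLink i.rev).symm
    simpa [AltSeq.reverse, Fin.rev_castSucc, Fin.rev_succ] using this
  edge_ne i j hij := (h.edge_ne j.rev i.rev (by simp only [Fin.val_rev]; omega)).symm

theorem IsArc.init {G : Graph α β} {A : AltSeq α β (ℓ + 1)} (h : IsArc G A) : IsArc G A.init where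
  vert_mem i := h.vert_mem _
  isLink i := h.isLink i.castSucc
  edge_ne i j hij := h.edge_ne i.castSucc j.castSucc (by simpa using hij)

/-- The set of `ℓ`-links of `G`. -/
def links (G : Graph α β) (ℓ : ℕ) : Set (UnorientedSeq α β ℓ) :=
  {L | ∃ A : AltSeq α β ℓ, IsArc G A ∧ unorient A = L}

/-- `L` can be shunted to `R` in one step through the `(ℓ + 1)`-link `Q` of `G`: for one of the two
orientations `A` of `Q`, the segments `A(0, ℓ)` and `A(1, ℓ + 1)` are orientations of `L`
and `R`. -/
def Shunts (G : Graph α β) (Q : UnorientedSeq α β (ℓ + 1)) (L R : UnorientedSeq α β ℓ) : Prop :=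
  ∃ A : AltSeq α β (ℓ + 1), IsArc G A ∧ unorient A = Q ∧ unorient A.init = L ∧ unorient A.tail = R

theorem Shunts.symm {G : Graph α β} {Q : UnorientedSeq α β (ℓ + 1)} {L R : UnorientedSeq α β ℓ}
    (h : Shunts G Q L R) : Shunts G Q R L := by
  obtain ⟨A, hA, rfl, rfl, rfl⟩ := h
  refine ⟨A.reverse, hA.reverse, unorient_reverse A, ?_, ?_⟩
  · rw [← AltSeq.reverse_tail, unorient_reverse]
  · rw [← AltSeq.reverse_init, unorient_reverse]

/-- The `ℓ`-link graph of `G`. Its vertices are the `ℓ`-links of `G`, its edges are the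
`(ℓ + 1)`-links of `G`, and the edges between `L` and `R` are exactly those `(ℓ + 1)`-links through
which `L` can be shunted to `R`. -/
def linkGraph (G : Graph α β) (ℓ : ℕ) :
    Graph (UnorientedSeq α β ℓ) (UnorientedSeq α β (ℓ + 1)) where
  vertexSet := links G ℓ
  edgeSet := links G (ℓ + 1)
  IsLink := Shunts G
  isLink_symm _ _ := ⟨fun _ _ h => h.symm⟩
  eq_or_eq_of_isLink_of_isLink := by
    rintro Q L R L' R' ⟨A, -, rfl, rfl, rfl⟩ ⟨B, -, hB, rfl, rfl⟩
    rcases unorient_eq_iff.1 hB.symm with rfl | rfl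
    · exact Or.inl rfl
    · right
      rw [← AltSeq.reverse_init, unorient_reverse]
  edge_mem_iff_exists_isLink Q := by
    constructor
    · rintro ⟨A, hA, rfl⟩
      exact ⟨_, _, A, hA, rfl, rfl, rfl⟩
    · rintro ⟨_, _, A, hA, hQ, -, -⟩
      exact ⟨A, hA, hQ⟩
  left_mem_of_isLink := by
    rintro Q L R ⟨A, hA, -, rfl, -⟩
    exact ⟨A.init, hA.init, rfl⟩

end

/-! ### Minors and the Hadwiger number -/

section

variable {α β γ δ : Type*}

/-- The set of all vertices that can be reached from `x` along edges of `G` in `F`. -/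
def contractionClass (G : Graph α β) (F : Set β) (x : α) : Set α :=
  {y | Relation.ReflTransGen (fun u v => ∃ e ∈ F, G.IsLink e u v) x y}

/-- The graph obtained from `G` by contracting all edges in `F`: the end vertices of each edge in `F`
are identified, so that the new vertices are the classes of vertices connected through `F`, and the
resulting loops are deleted. -/
def contract (G : Graph α β) (F : Set β) : Graph (Set α) β where
  vertexSet := contractionClass G F '' V(G)
  IsLink e X Y := ∃ x y, G.IsLink e x y ∧
    X = contractionClass G F x ∧ Y = contractionClass G F y ∧ X ≠ Y
  isLink_symm _ _ := ⟨by
    rintro X Y ⟨x, y, h, hX, hY, hne⟩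
    exact ⟨y, x, h.symm, hY, hX, hne.symm⟩⟩
  eq_or_eq_of_isLink_of_isLink := by
    rintro e X Y X' Y' ⟨x, y, h, rfl, rfl, -⟩ ⟨x', y', h', rfl, rfl, -⟩
    rcases h.left_eq_or_eq h' with rfl | rfl
    · exact Or.inl rfl
    · exact Or.inr rfl
  left_mem_of_isLink := by
    rintro e X Y ⟨x, y, h, rfl, -, -⟩
    exact ⟨x, h.left_mem, rfl⟩

/-- Isomorphisms of multigraphs. -/
structure GraphIso (G : Graph α β) (H : Graph γ δ) where
  onVertices : V(G) ≃ V(H)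
  onEdges : E(G) ≃ E(H)
  isLink_iff : ∀ (e : E(G)) (x y : V(G)),
    G.IsLink e x y ↔ H.IsLink (onEdges e) (onVertices x) (onVertices y)

/-- `G` contains an `M`-minor: a graph isomorphic to `M` can be obtained from a subgraph of `G` by
contracting edges. -/
def HasMinor (G : Graph α β) (M : Graph γ δ) : Prop :=
  ∃ K ≤ G, ∃ F ⊆ E(K), Nonempty (GraphIso M (contract K F))

/-- The complete graph `K_t`. -/
def complete (t : ℕ) : Graph (Fin t) (Sym2 (Fin t)) :=
  Graph.ofSimpleGraph (⊤ : SimpleGraph (Fin t))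

/-- The Hadwiger number: the largest `t` such that `G` contains a `K_t`-minor (`⊤` if there is no
largest one, which does not happen for graphs with finitely many vertices). -/
noncomputable def hadwigerNumber (G : Graph α β) : ℕ∞ :=
  ⨆ (t : ℕ) (_ : HasMinor G (complete t)), (t : ℕ∞)

/-! ### Degeneracy -/

/-- The degree of `x` in a loopless graph: the number of edges incident to `x`, where parallel edges
are counted separately. -/
noncomputable def degree (G : Graph α β) (x : α) : ℕ∞ := (G.incidenceSet x).encard

/-- The minimum degree (of a graph that has a vertex). -/
noncomputable def minDegree (G : Graph α β) : ℕ∞ := ⨅ x ∈ V(G), degree G x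

/-- The degeneracy: the maximum of the minimum degrees of the subgraphs of `G` with at least one
vertex. -/
noncomputable def degeneracy (G : Graph α β) : ℕ∞ :=
  ⨆ (H : Graph α β) (_ : H ≤ G ∧ V(H).Nonempty), minDegree H

end

end LinkGraphs

/-!
Let `W` be a set of vertices of a loopless graph `G` such that each `y ∈ W` can be assigned an
edge `out y` from `y` to a vertex `nxt y ∈ W`, with different edges for different vertices
(`IsOutAssignment`). Following the assignment from `y` gives an infinite non-backtracking walk,
whose initial segment of length `ℓ` is an `ℓ`-link `A y`. The links `A y` are pairwise different
(`IsOutAssignment.link_injOn`), and `A y` is adjacent to `A (nxt y)` in the link graph. If `e` is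
an unassigned edge from `x` to `y`, then shunting along the two-way infinite walk that arrives
along the walk of `x` reversed, crosses `e` and leaves along the walk of `y` gives a path from
`A x` to `A y`. The inner vertices of this path are links that contain `e` and no other unassigned
edge, so the paths for different edges are disjoint. Hence the link graph contains a subdivision
of `G[W]`, and every complete minor of `G[W]` is one of the link graph
(`IsOutAssignment.exists_isCliqueModel`).

A `K_t`-minor of `G` with `t ≥ 3` and as few vertices as possible has at least two edges at each
vertex within the union of its branch sets. By Hall's theorem this union has an assignment
(`IsCliqueModel.exists_isOutAssignment`). This bounds the Hadwiger number.

For the degeneracy, let `d ≥ 3`, and let `W` be a nonempty vertex set as small as possible such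
that every vertex of `W` has at least `d` edges into `W`. If `W` has more than two vertices, then
some nonempty proper subset of `W` has an assignment. A maximal such subset `U` is all of `W`
except for one vertex `v`, since a further vertex with an edge into `U` could be added to it, and
without such an edge `U` would be a smaller choice of `W`. The `d` edges from `v` into `U`, each
continued along the assignment, are `d` walks from `v`. Shunting from one of them through `v` to
another gives a subdivision of `K_d` in the link graph (`exists_isCliqueModel_of_rays`). If `W`
consists of two vertices joined by `d` parallel edges, the same construction gives a
`K_{d-1}`-minor, and one more link is adjacent to all its branch sets
(`exists_isCliqueModel_of_parallel`).

Minors with at most two vertices exist because the link graph is loopless and has an edge.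
-/

namespace LinkGraphs

open Relation

section

variable {α β : Type*} {t : ℕ}

/-! ### Complete minors as families of branch sets -/

/-- `y` can be reached from `x` along edges of `G` with both ends in `B`. -/
def Linked (G : Graph α β) (B : Set α) : α → α → Prop :=
  ReflTransGen fun u v => u ∈ B ∧ v ∈ B ∧ G.Adj u v

theorem Linked.symm {G : Graph α β} {B : Set α} {x y : α} (h : Linked G B x y) :
    Linked G B y x := by
  induction h with
  | refl => exact .refl
  | tail _ h ih => exact .head ⟨h.2.1, h.1, h.2.2.symm⟩ ih

theorem Linked.trans {G : Graph α β} {B : Set α} {x y z : α} (h : Linked G B x y)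
    (h' : Linked G B y z) : Linked G B x z :=
  ReflTransGen.trans h h'

theorem Linked.single {G : Graph α β} {B : Set α} {x y : α} (hx : x ∈ B) (hy : y ∈ B)
    (h : G.Adj x y) : Linked G B x y :=
  ReflTransGen.single ⟨hx, hy, h⟩

/-- A sequence of consecutively adjacent vertices of `B` links its first term to each later one. -/
theorem Linked.of_seq {G : Graph α β} {B : Set α} (w : ℕ → α) (m : ℕ) (hw : ∀ k ≤ m, w k ∈ B)
    (hadj : ∀ k < m, G.Adj (w k) (w (k + 1))) {k : ℕ} (hk : k ≤ m) : Linked G B (w 0) (w k) := by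
  induction k with
  | zero => exact .refl
  | succ k ih =>
    exact (ih (by omega)).trans (.single (hw k (by omega)) (hw _ hk) (hadj k (by omega)))

/-- The sets `B 0, …, B (t - 1)` are the branch sets of a `K_t`-minor of `G`: they are nonempty,
connected, pairwise disjoint and pairwise joined by an edge. -/
structure IsCliqueModel (G : Graph α β) (B : Fin t → Set α) : Prop where
  subset : ∀ i, B i ⊆ V(G)
  nonempty : ∀ i, (B i).Nonempty
  linked : ∀ i, ∀ x ∈ B i, ∀ y ∈ B i, Linked G (B i) x y
  eq_of_mem : ∀ i j x, x ∈ B i → x ∈ B j → i = j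
  adj : ∀ i j, i < j → ∃ x ∈ B i, ∃ y ∈ B j, G.Adj x y

theorem IsCliqueModel.adj_of_ne {G : Graph α β} {B : Fin t → Set α} (h : IsCliqueModel G B)
    {i j : Fin t} (hij : i ≠ j) : ∃ x ∈ B i, ∃ y ∈ B j, G.Adj x y := by
  rcases lt_or_gt_of_ne hij with hij | hij
  · exact h.adj i j hij
  · obtain ⟨x, hx, y, hy, hxy⟩ := h.adj j i hij
    exact ⟨y, hy, x, hx, hxy.symm⟩

theorem contractionClass_symm {G : Graph α β} {F : Set β} {x y : α}
    (h : y ∈ contractionClass G F x) : x ∈ contractionClass G F y := by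
  change ReflTransGen _ x y at h
  change ReflTransGen _ y x
  induction h with
  | refl => exact .refl
  | tail _ h ih =>
    obtain ⟨e, he, h⟩ := h
    exact .head ⟨e, he, h.symm⟩ ih

theorem contractionClass_eq_of_mem {G : Graph α β} {F : Set β} {x y : α}
    (h : y ∈ contractionClass G F x) : contractionClass G F y = contractionClass G F x := by
  ext z
  exact ⟨fun hz => ReflTransGen.trans h hz,
    fun hz => ReflTransGen.trans (contractionClass_symm h) hz⟩

theorem linked_contractionClass {G K : Graph α β} (hK : K ≤ G) {F : Set β} {x y : α}
    (h : y ∈ contractionClass K F x) : Linked G (contractionClass K F x) x y := by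
  change ReflTransGen _ x y at h
  induction h with
  | refl => exact .refl
  | tail h h' ih =>
    refine ih.trans (.single h (ReflTransGen.tail h h') ?_)
    obtain ⟨e, -, he⟩ := h'
    exact ⟨e, he.mono hK⟩

theorem HasMinor.exists_isCliqueModel {G : Graph α β} (h : HasMinor G (complete t)) :
    ∃ B : Fin t → Set α, IsCliqueModel G B := by
  obtain ⟨K, hK, F, -, ⟨φ⟩⟩ := h
  have hcls (i : Fin t) : ∃ x ∈ V(K), contractionClass K F x = φ.onVertices ⟨i, trivial⟩ :=
    (φ.onVertices ⟨i, trivial⟩).2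
  choose c hcV hc using hcls
  refine ⟨fun i => contractionClass K F (c i), ?_, ?_, ?_, ?_, ?_⟩
  · intro i y hy
    change ReflTransGen _ _ _ at hy
    induction hy with
    | refl => exact hK.vertexSet_mono (hcV i)
    | tail _ h _ =>
      obtain ⟨e, -, he⟩ := h
      exact (he.mono hK).right_mem
  · exact fun i => ⟨c i, .refl⟩
  · exact fun i x hx y hy =>
      (linked_contractionClass hK hx).symm.trans (linked_contractionClass hK hy)
  · intro i j x hi hj
    have h := (contractionClass_eq_of_mem hi).symm.trans (contractionClass_eq_of_mem hj)
    rw [hc, hc] at h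
    exact congrArg Subtype.val (φ.onVertices.injective (Subtype.ext h))
  · intro i j hij
    have he : s(i, j) ∈ E(complete t) := by
      simp [complete, hij.ne]
    have := (φ.isLink_iff ⟨s(i, j), he⟩ ⟨i, trivial⟩ ⟨j, trivial⟩).1 ⟨rfl, he⟩
    obtain ⟨x, y, hxy, hX, hY, -⟩ := this
    refine ⟨x, ?_, y, ?_, _, hxy.mono hK⟩
    · rw [hc, hX]
      exact .refl
    · rw [hc, hY]
      exact .refl

theorem IsCliqueModel.hasMinor {G : Graph α β} {B : Fin t → Set α} (h : IsCliqueModel G B) :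
    HasMinor G (complete t) := by
  classical
  have hedge : ∀ s : E(complete t), ∃ e, ∀ i j, s.1 = s(i, j) →
      ∃ x ∈ B i, ∃ y ∈ B j, G.IsLink e x y := by
    rintro ⟨s, hs⟩
    induction s with
    | h a b =>
      have hab : a ≠ b := by simpa [complete] using hs
      obtain ⟨x, hx, y, hy, e, he⟩ := h.adj_of_ne hab
      refine ⟨e, fun i j hij => ?_⟩
      rcases Sym2.eq_iff.1 hij with ⟨rfl, rfl⟩ | ⟨rfl, rfl⟩
      · exact ⟨x, hx, y, hy, he⟩
      · exact ⟨y, hy, x, hx, he.symm⟩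
  choose g hg using hedge
  have hgB : ∀ (s : E(complete t)) (x y : α), G.IsLink (g s) x y →
      ∃ i j, i ≠ j ∧ s.1 = s(i, j) ∧ x ∈ B i ∧ y ∈ B j := by
    rintro ⟨s, hs⟩ x y hxy
    induction s with
    | h a b =>
      have hab : a ≠ b := by simpa [complete] using hs
      obtain ⟨x', hx', y', hy', h'⟩ := hg ⟨s(a, b), hs⟩ a b rfl
      rcases hxy.eq_and_eq_or_eq_and_eq h' with ⟨rfl, rfl⟩ | ⟨rfl, rfl⟩
      · exact ⟨a, b, hab, rfl, hx', hy'⟩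
      · exact ⟨b, a, hab.symm, Sym2.eq_swap, hy', hx'⟩
  let K : Graph α β :=
    { vertexSet := ⋃ i, B i
      IsLink := fun e x y => G.IsLink e x y ∧
        ((∃ i, x ∈ B i ∧ y ∈ B i) ∨ ∃ s : E(complete t), e = g s)
      isLink_symm := fun e _ => ⟨fun x y hxy => ⟨hxy.1.symm,
        hxy.2.imp (fun ⟨i, hi⟩ => ⟨i, hi.symm⟩) id⟩⟩
      eq_or_eq_of_isLink_of_isLink := fun e x y v w h h' => h.1.left_eq_or_eq h'.1
      left_mem_of_isLink := by
        rintro e x y ⟨hxy, ⟨i, hi, -⟩ | ⟨s, rfl⟩⟩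
        · exact Set.mem_iUnion.2 ⟨i, hi⟩
        · obtain ⟨i, j, -, -, hi, -⟩ := hgB s x y hxy
          exact Set.mem_iUnion.2 ⟨i, hi⟩ }
  have hKG : K ≤ G :=
    ⟨Set.iUnion_subset h.subset, fun e x y hxy => hxy.1⟩
  let F : Set β := {e | ∃ i, ∃ x ∈ B i, ∃ y ∈ B i, G.IsLink e x y}
  have hF : F ⊆ E(K) := by
    rintro e ⟨i, x, hx, y, hy, hxy⟩
    exact (show K.IsLink e x y from ⟨hxy, Or.inl ⟨i, hx, hy⟩⟩).edge_mem
  have hclass : ∀ i, ∀ x ∈ B i, contractionClass K F x = B i := by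
    intro i x hx
    ext y
    constructor
    · intro hy
      change ReflTransGen _ _ _ at hy
      induction hy with
      | refl => exact hx
      | tail _ h' ih =>
        obtain ⟨e, ⟨j, a, ha, b, hb, hab⟩, huv⟩ := h'
        rcases huv.1.eq_and_eq_or_eq_and_eq hab with ⟨rfl, rfl⟩ | ⟨rfl, rfl⟩
        · rwa [h.eq_of_mem i j _ ih ha]
        · rwa [h.eq_of_mem i j _ ih hb]
    · intro hy
      have hl := h.linked i x hx y hy
      change ReflTransGen _ _ _
      refine ReflTransGen.mono ?_ _ _ hl
      rintro u v ⟨hu, hv, e, he⟩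
      exact ⟨e, ⟨i, u, hu, v, hv, he⟩, he, Or.inl ⟨i, hu, hv⟩⟩
  have hBinj : Function.Injective B := fun i j hij => by
    obtain ⟨x, hx⟩ := h.nonempty i
    exact h.eq_of_mem i j x hx (hij ▸ hx)
  have hBV : ∀ i, B i ∈ V(contract K F) := fun i => by
    obtain ⟨x, hx⟩ := h.nonempty i
    exact ⟨x, Set.mem_iUnion.2 ⟨i, hx⟩, hclass i x hx⟩
  have hlink : ∀ (s : E(complete t)) i j, (complete t).IsLink s i j ↔
      (contract K F).IsLink (g s) (B i) (B j) := by
    intro s i j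
    constructor
    · rintro ⟨hs, hmem⟩
      obtain ⟨x, hx, y, hy, hxy⟩ := hg s i j hs
      refine ⟨x, y, ⟨hxy, Or.inr ⟨s, rfl⟩⟩, (hclass i x hx).symm, (hclass j y hy).symm,
        fun hB => ?_⟩
      rw [hs, hBinj hB] at hmem
      simp at hmem
    · rintro ⟨x, y, ⟨hxy, -⟩, hX, hY, hne⟩
      obtain ⟨a, b, hab, hs, ha, hb⟩ := hgB s x y hxy
      rw [hclass a x ha] at hX
      rw [hclass b y hb] at hY
      rw [hBinj hX, hBinj hY]
      exact ⟨hs, s.2⟩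
  refine ⟨K, hKG, F, hF, ⟨⟨?_, ?_, ?_⟩⟩⟩
  · refine Equiv.ofBijective (fun i => ⟨B i.1, hBV i.1⟩) ⟨?_, ?_⟩
    · intro i j hij
      exact Subtype.ext (hBinj (congrArg Subtype.val hij))
    · rintro ⟨X, x, hx, rfl⟩
      obtain ⟨i, hi⟩ := Set.mem_iUnion.1 hx
      exact ⟨⟨i, trivial⟩, Subtype.ext (hclass i x hi).symm⟩
  · refine Equiv.ofBijective (fun s => ⟨g s, ?_⟩) ⟨?_, ?_⟩
    · obtain ⟨i, j, hij⟩ := Graph.exists_isLink_of_mem_edgeSet s.2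
      exact ((hlink s i j).1 hij).edge_mem
    · intro s s' hss
      have hss : g s = g s' := congrArg Subtype.val hss
      obtain ⟨i, j, hij⟩ := Graph.exists_isLink_of_mem_edgeSet s.2
      have h1 := (hlink s i j).1 hij
      rw [hss] at h1
      exact Subtype.ext (hij.1.trans ((hlink s' i j).2 h1).1.symm)
    · rintro ⟨e, he⟩
      obtain ⟨X, Y, hXY⟩ := Graph.exists_isLink_of_mem_edgeSet he
      obtain ⟨x, y, ⟨hxy, ⟨i, hi, hi'⟩ | ⟨s, rfl⟩⟩, rfl, rfl, hne⟩ := hXY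
      · exact absurd ((hclass i x hi).trans (hclass i y hi').symm) hne
      · exact ⟨s, rfl⟩
  · intro s i j
    exact hlink s i j

/-- Adding a vertex that is adjacent to every branch set of a `K_t`-minor. -/
theorem IsCliqueModel.cons {G : Graph α β} {B : Fin t → Set α} (h : IsCliqueModel G B) {x : α}
    (hx : ∀ i, x ∉ B i) (hV : x ∈ V(G)) (hadj : ∀ i, ∃ y ∈ B i, G.Adj x y) :
    IsCliqueModel G (Fin.cons {x} B : Fin (t + 1) → Set α) where
  subset i := by
    cases i using Fin.cases with
    | zero => simpa using hV
    | succ i => simpa using h.subset i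
  nonempty i := by
    cases i using Fin.cases with
    | zero => simp
    | succ i => simpa using h.nonempty i
  linked i := by
    cases i using Fin.cases with
    | zero =>
      rintro a ha b hb
      simp only [Fin.cons_zero, Set.mem_singleton_iff] at ha hb
      rw [ha, hb]
      exact .refl
    | succ i => simpa using h.linked i
  eq_of_mem i j y hi hj := by
    cases i using Fin.cases with
    | zero =>
      cases j using Fin.cases with
      | zero => rfl
      | succ j =>
        simp only [Fin.cons_zero, Set.mem_singleton_iff, Fin.cons_succ] at hi hj
        exact absurd (hi ▸ hj) (hx j)
    | succ i =>
      cases j using Fin.cases with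
      | zero =>
        simp only [Fin.cons_zero, Set.mem_singleton_iff, Fin.cons_succ] at hi hj
        exact absurd (hj ▸ hi) (hx i)
      | succ j => rw [h.eq_of_mem i j y (by simpa using hi) (by simpa using hj)]
  adj i j hij := by
    cases j using Fin.cases with
    | zero => exact absurd hij (by simp)
    | succ j =>
      cases i using Fin.cases with
      | zero => simpa using hadj j
      | succ i => simpa using h.adj i j (by simpa using hij)

theorem IsCliqueModel.le_hadwigerNumber {G : Graph α β} {B : Fin t → Set α}
    (h : IsCliqueModel G B) : (t : ℕ∞) ≤ hadwigerNumber G :=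
  le_iSup₂_of_le t h.hasMinor le_rfl

end

section

variable {α β : Type*} {ℓ : ℕ} {G : Graph α β}

/-! ### Rays and the links along them -/

/-- A one-way infinite alternating sequence `(v₀, e₁, v₁, e₂, …)`; `vert k` is `v_k`, and `edge k`
stands between `vert k` and `vert (k + 1)`. Vertices and edges may repeat. -/
structure Ray (α β : Type*) where
  vert : ℕ → α
  edge : ℕ → β

/-- All initial segments of the ray `R` are arcs of `G`. -/
structure IsRay (G : Graph α β) (R : Ray α β) : Prop where
  isLink : ∀ k, G.IsLink (R.edge k) (R.vert k) (R.vert (k + 1))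
  edge_ne : ∀ k, R.edge k ≠ R.edge (k + 1)

namespace Ray

/-- The ray without its first vertex and edge. -/
def tail (R : Ray α β) : Ray α β where
  vert k := R.vert (k + 1)
  edge k := R.edge (k + 1)

/-- The ray `R` preceded by the vertex `x` and the edge `e`. -/
def cons (x : α) (e : β) (R : Ray α β) : Ray α β where
  vert | 0 => x | k + 1 => R.vert k
  edge | 0 => e | k + 1 => R.edge k

/-- The initial segment of length `ℓ`. -/
def segment (R : Ray α β) (ℓ : ℕ) : AltSeq α β ℓ where
  vert i := R.vert i
  edge i := R.edge i

/-- For rays `R` and `S` with the same first vertex, the sequence of length `ℓ` that runs backwards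
along the first `k` edges of `R` and then forwards along `S`. -/
def glue (R S : Ray α β) (ℓ k : ℕ) : AltSeq α β ℓ where
  vert i := if (i : ℕ) ≤ k then R.vert (k - i) else S.vert (i - k)
  edge i := if (i : ℕ) < k then R.edge (k - 1 - i) else S.edge (i - k)

/-- The unoriented initial segment of length `ℓ` of a ray. -/
def link (R : Ray α β) (ℓ : ℕ) : UnorientedSeq α β ℓ := unorient (R.segment ℓ)

/-- The unoriented sequence obtained from `R.glue S ℓ k`. -/
def bend (R S : Ray α β) (ℓ k : ℕ) : UnorientedSeq α β ℓ := unorient (R.glue S ℓ k)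

theorem bend_zero {R S : Ray α β} (h : R.vert 0 = S.vert 0) (ℓ : ℕ) :
    R.bend S ℓ 0 = S.link ℓ := by
  refine congrArg unorient (AltSeq.ext (funext fun i => ?_) (funext fun i => ?_))
  · by_cases hi : i = 0 <;> simp [glue, segment, hi, h]
  · simp [glue, segment]

theorem bend_self (R S : Ray α β) (ℓ : ℕ) : R.bend S ℓ ℓ = R.link ℓ := by
  rw [link, ← unorient_reverse]
  refine congrArg unorient (AltSeq.ext (funext fun i => ?_) (funext fun i => ?_))
  · have : (i : ℕ) ≤ ℓ := by omega
    simp [glue, segment, AltSeq.reverse, this]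
  · simp only [glue, segment, AltSeq.reverse, i.2, if_true, Fin.val_rev]
    congr 1
    omega

theorem glue_init (R S : Ray α β) (ℓ k : ℕ) :
    (R.glue S (ℓ + 1) k).init = R.glue S ℓ k := rfl

theorem glue_tail (R S : Ray α β) (ℓ k : ℕ) :
    (R.glue S (ℓ + 1) (k + 1)).tail = R.glue S ℓ k := by
  refine AltSeq.ext (funext fun i => ?_) (funext fun i => ?_)
  · simp [glue, AltSeq.tail]
  · simp only [glue, AltSeq.tail, Fin.val_succ, Nat.add_lt_add_iff_right, Nat.add_sub_add_right]
    congr 2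
    omega

end Ray

theorem IsRay.tail {R : Ray α β} (h : IsRay G R) : IsRay G R.tail where
  isLink k := h.isLink (k + 1)
  edge_ne k := h.edge_ne (k + 1)

theorem IsRay.cons {R : Ray α β} (h : IsRay G R) {x : α} {e : β} (he : G.IsLink e x (R.vert 0))
    (hne : e ≠ R.edge 0) : IsRay G (R.cons x e) where
  isLink
    | 0 => he
    | k + 1 => h.isLink k
  edge_ne
    | 0 => hne
    | k + 1 => h.edge_ne k

theorem IsRay.isArc_segment {R : Ray α β} (h : IsRay G R) (ℓ : ℕ) : IsArc G (R.segment ℓ) where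
  vert_mem i := (h.isLink i).left_mem
  isLink i := h.isLink i
  edge_ne i j hij := by
    simp only [Ray.segment, ← hij]
    exact h.edge_ne i

theorem IsRay.link_mem {R : Ray α β} (h : IsRay G R) (ℓ : ℕ) :
    R.link ℓ ∈ V(linkGraph G ℓ) :=
  ⟨_, h.isArc_segment ℓ, rfl⟩

theorem IsRay.adj_tail {R : Ray α β} (h : IsRay G R) (ℓ : ℕ) :
    (linkGraph G ℓ).Adj (R.link ℓ) (R.tail.link ℓ) :=
  ⟨_, R.segment (ℓ + 1), h.isArc_segment _, rfl, rfl, rfl⟩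

theorem IsRay.isArc_glue {R S : Ray α β} (hR : IsRay G R) (hS : IsRay G S)
    (h0 : R.vert 0 = S.vert 0) (hne : R.edge 0 ≠ S.edge 0) (ℓ k : ℕ) :
    IsArc G (R.glue S ℓ k) where
  vert_mem i := by
    simp only [Ray.glue]
    split_ifs
    · exact (hR.isLink _).left_mem
    · exact (hS.isLink _).left_mem
  isLink i := by
    simp only [Ray.glue, Fin.val_castSucc, Fin.val_succ]
    rcases lt_trichotomy (i : ℕ) k with hi | hi | hi
    · have := (hR.isLink (k - 1 - i)).symm
      rw [if_pos hi, if_pos hi.le, if_pos (by omega)]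
      convert this using 2 <;> omega
    · have := hS.isLink 0
      simpa [hi, h0] using this
    · have := hS.isLink (i - k)
      rw [if_neg (by omega), if_neg (by omega), if_neg (by omega)]
      convert this using 2
      omega
  edge_ne i j hij := by
    simp only [Ray.glue, ← hij]
    rcases lt_trichotomy ((i : ℕ) + 1) k with hi | hi | hi
    · have := (hR.edge_ne (k - 1 - (i + 1))).symm
      rw [if_pos (by omega), if_pos hi]
      convert this using 2
      omega
    · rw [if_pos (by omega), if_neg (by omega)]
      convert hne using 2 <;> omega
    · have := hS.edge_ne (i - k)
      rw [if_neg (by omega), if_neg (by omega)]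
      convert this using 2
      omega

theorem IsRay.bend_mem {R S : Ray α β} (hR : IsRay G R) (hS : IsRay G S)
    (h0 : R.vert 0 = S.vert 0) (hne : R.edge 0 ≠ S.edge 0) (ℓ k : ℕ) :
    R.bend S ℓ k ∈ V(linkGraph G ℓ) :=
  ⟨_, hR.isArc_glue hS h0 hne ℓ k, rfl⟩

theorem IsRay.adj_bend {R S : Ray α β} (hR : IsRay G R) (hS : IsRay G S)
    (h0 : R.vert 0 = S.vert 0) (hne : R.edge 0 ≠ S.edge 0) (ℓ k : ℕ) :
    (linkGraph G ℓ).Adj (R.bend S ℓ k) (R.bend S ℓ (k + 1)) := by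
  refine Graph.Adj.symm ⟨_, R.glue S (ℓ + 1) (k + 1), hR.isArc_glue hS h0 hne _ _, rfl, ?_, ?_⟩
  · rw [Ray.glue_init, Ray.bend]
  · rw [Ray.glue_tail, Ray.bend]

/-- The edges that occur in an unoriented sequence. -/
def linkEdges (L : UnorientedSeq α β ℓ) : Set β :=
  Quotient.lift (fun A : AltSeq α β ℓ => Set.range A.edge) (by
    rintro A B (rfl | rfl)
    · rfl
    · exact (Fin.rev_surjective.range_comp A.edge).symm) L

theorem mem_linkEdges_link {R : Ray α β} {e : β} :
    e ∈ linkEdges (R.link ℓ) ↔ ∃ i < ℓ, R.edge i = e :=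
  ⟨fun ⟨i, hi⟩ => ⟨i, i.2, hi⟩, fun ⟨i, hi, h⟩ => ⟨⟨i, hi⟩, h⟩⟩

theorem mem_linkEdges_bend {R S : Ray α β} {e : β} {k : ℕ} (hk : k ≤ ℓ) :
    e ∈ linkEdges (R.bend S ℓ k) ↔ (∃ i < k, R.edge i = e) ∨ ∃ i < ℓ - k, S.edge i = e := by
  constructor
  · rintro ⟨i, hi⟩
    simp only [Ray.glue] at hi
    split_ifs at hi with h
    · exact Or.inl ⟨_, by omega, hi⟩
    · exact Or.inr ⟨_, by omega, hi⟩
  · rintro (⟨i, hi, h⟩ | ⟨i, hi, h⟩)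
    · refine ⟨⟨k - 1 - i, by omega⟩, ?_⟩
      simp only [Ray.glue]
      rw [if_pos (by omega), ← h]
      congr 1
      omega
    · refine ⟨⟨k + i, by omega⟩, ?_⟩
      simp only [Ray.glue]
      rw [if_neg (by omega), ← h]
      congr 1
      omega

/-! ### Out-edge assignments -/

/-- Each vertex `y ∈ W` is assigned an edge `out y` of `G`, different ones for different vertices,
that joins `y` to a vertex `nxt y ∈ W`. -/
structure IsOutAssignment (G : Graph α β) (W : Set α) (out : α → β) (nxt : α → α) : Prop where
  nxt_mem : ∀ y ∈ W, nxt y ∈ W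
  isLink : ∀ y ∈ W, G.IsLink (out y) y (nxt y)
  injOn : Set.InjOn out W

/-- The ray that starts at `y` and leaves each vertex through its assigned edge. -/
def outRay (out : α → β) (nxt : α → α) (y : α) : Ray α β where
  vert k := nxt^[k] y
  edge k := out (nxt^[k] y)

variable {W : Set α} {out : α → β} {nxt : α → α}

namespace IsOutAssignment

theorem iterate_mem (h : IsOutAssignment G W out nxt) {y : α} (hy : y ∈ W) (k : ℕ) :
    nxt^[k] y ∈ W := by
  induction k with
  | zero => exact hy
  | succ k ih =>
    rw [Function.iterate_succ_apply']
    exact h.nxt_mem _ ih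

theorem nxt_ne [G.Loopless] (h : IsOutAssignment G W out nxt) {y : α} (hy : y ∈ W) :
    y ≠ nxt y :=
  (h.isLink y hy).ne

theorem isRay [G.Loopless] (h : IsOutAssignment G W out nxt) {y : α} (hy : y ∈ W) :
    IsRay G (outRay out nxt y) where
  isLink k := by
    simp only [outRay, Function.iterate_succ_apply']
    exact h.isLink _ (h.iterate_mem hy k)
  edge_ne k hk := by
    have := h.injOn (h.iterate_mem hy k) (h.iterate_mem hy (k + 1)) hk
    rw [Function.iterate_succ_apply'] at this
    exact h.nxt_ne (h.iterate_mem hy k) this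

theorem edge_mem (h : IsOutAssignment G W out nxt) {y : α} (hy : y ∈ W) (k : ℕ) :
    (outRay out nxt y).edge k ∈ out '' W :=
  ⟨_, h.iterate_mem hy k, rfl⟩

theorem link_adj [G.Loopless] (h : IsOutAssignment G W out nxt) {y : α} (hy : y ∈ W) (ℓ : ℕ) :
    (linkGraph G ℓ).Adj ((outRay out nxt y).link ℓ) ((outRay out nxt (nxt y)).link ℓ) :=
  (h.isRay hy).adj_tail ℓ

/-- Different vertices start different links of the assignment, even up to reversal: if the link
from `z` were the reverse of the link from `y`, then its first edge would be the assigned edge of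
its second vertex as well. -/
theorem link_injOn [G.Loopless] (h : IsOutAssignment G W out nxt) (hℓ : 1 ≤ ℓ) :
    Set.InjOn (fun y => (outRay out nxt y).link ℓ) W := by
  intro y hy z hz hyz
  rcases unorient_eq_iff.1 hyz with hA | hA
  · exact (congrArg (fun A => A.vert 0) hA).symm
  · have he := congrArg (fun A => A.edge ⟨0, hℓ⟩) hA
    have hv := congrArg (fun A => A.vert ⟨1, by omega⟩) hA
    simp only [outRay, Ray.segment, AltSeq.reverse, Fin.val_rev] at he hv
    have hz' := h.injOn hz (h.iterate_mem hy _) he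
    rw [show ℓ + 1 - (1 + 1) = ℓ - (0 + 1) by omega, ← hz'] at hv
    exact absurd hv.symm (h.nxt_ne hz)

/-- The ray that first crosses the unassigned edge `e` from `x` to `y` and then follows the
assignment. -/
theorem isRay_cons [G.Loopless] (h : IsOutAssignment G W out nxt) {x y : α} {e : β} (hy : y ∈ W)
    (he : G.IsLink e x y) (hne : e ∉ out '' W) : IsRay G ((outRay out nxt y).cons x e) :=
  (h.isRay hy).cons he fun hc => hne ⟨y, hy, hc.symm⟩

end IsOutAssignment

end

section

variable {α β : Type*} {ℓ t : ℕ} {G : Graph α β} {W : Set α} {out : α → β} {nxt : α → α}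

/-- If every vertex of `W` has two edges within `W`, then these edges can be assigned by Hall's
theorem, because an edge has only two ends. -/
theorem exists_isOutAssignment (hW : W.Nonempty)
    (hdeg : ∀ y ∈ W, ∃ e f, e ≠ f ∧ (∃ z ∈ W, G.IsLink e y z) ∧ ∃ z ∈ W, G.IsLink f y z) :
    ∃ out nxt, IsOutAssignment G W out nxt := by
  classical
  have hdeg' : ∀ y : W, ∃ s : Finset β, s.card = 2 ∧ ∀ e ∈ s, ∃ z ∈ W, G.IsLink e y z := by
    rintro ⟨y, hy⟩
    obtain ⟨e, f, hef, he, hf⟩ := hdeg y hy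
    refine ⟨{e, f}, Finset.card_pair hef, fun e' he' => ?_⟩
    rcases Finset.mem_insert.1 he' with rfl | he'
    · exact he
    · rwa [Finset.mem_singleton.1 he']
  choose s hs hlink using hdeg'
  have hall : ∀ S : Finset W, S.card ≤ (S.biUnion s).card := by
    intro S
    refine Nat.le_of_mul_le_mul_right (c := 2) ?_ two_pos
    refine Finset.card_mul_le_card_mul (fun y e => e ∈ s y) ?_ ?_
    · intro y hy
      rw [← hs y]
      exact Finset.card_le_card fun e he =>
        (Finset.mem_bipartiteAbove _).2 ⟨Finset.mem_biUnion.2 ⟨y, hy, he⟩, he⟩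
    · intro e _
      by_contra! h
      obtain ⟨a, b, c, ha, hb, hc, hab, hac, hbc⟩ := Finset.two_lt_card_iff.1 h
      have hinc : ∀ y, y ∈ S.bipartiteBelow (fun y e => e ∈ s y) e → G.Inc e y := by
        intro y hy
        obtain ⟨z, -, hz⟩ := hlink y e ((Finset.mem_bipartiteBelow _).1 hy).2
        exact ⟨z, hz⟩
      rcases (hinc a ha).eq_or_eq_or_eq (hinc b hb) (hinc c hc) with h | h | h
      · exact hab (Subtype.ext h)
      · exact hac (Subtype.ext h)
      · exact hbc (Subtype.ext h)
  obtain ⟨f, hf, hfs⟩ := (Finset.all_card_le_biUnion_card_iff_exists_injective s).1 hall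
  choose n hn hfn using fun y => hlink y (f y) (hfs y)
  obtain ⟨y₀, hy₀⟩ := hW
  refine ⟨fun y => if h : y ∈ W then f ⟨y, h⟩ else f ⟨y₀, hy₀⟩,
    fun y => if h : y ∈ W then n ⟨y, h⟩ else y, ?_, ?_, ?_⟩
  · intro y hy
    simpa [hy] using hn ⟨y, hy⟩
  · intro y hy
    simpa [hy] using hfn ⟨y, hy⟩
  · intro y hy z hz hyz
    simp only [hy, hz, dif_pos] at hyz
    exact congrArg Subtype.val (hf hyz)

theorem IsOutAssignment.exists_insert (h : IsOutAssignment G W out nxt) {z u : α} (hz : z ∉ W)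
    {e : β} (hu : u ∈ W) (he : G.IsLink e z u) :
    ∃ out' nxt', IsOutAssignment G (insert z W) out' nxt' := by
  classical
  have hne : ∀ y ∈ W, y ≠ z := fun y hy hyz => hz (hyz ▸ hy)
  have hnew : ∀ y ∈ W, out y ≠ e := by
    rintro y hy rfl
    rcases he.left_eq_or_eq (h.isLink y hy) with rfl | rfl
    · exact hz hy
    · exact hz (h.nxt_mem y hy)
  refine ⟨Function.update out z e, Function.update nxt z u, ?_, ?_, ?_⟩
  · rintro y (rfl | hy)
    · simpa using Or.inr hu
    · simpa [hne y hy] using Or.inr (h.nxt_mem y hy)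
  · rintro y (rfl | hy)
    · simpa using he
    · simpa [hne y hy] using h.isLink y hy
  · rintro y (rfl | hy) y' (rfl | hy') hyy
    · rfl
    · simp only [Function.update_self, Function.update_of_ne (hne y' hy')] at hyy
      exact absurd hyy.symm (hnew y' hy')
    · simp only [Function.update_self, Function.update_of_ne (hne y hy)] at hyy
      exact absurd hyy (hnew y hy)
    · simp only [Function.update_of_ne (hne y hy), Function.update_of_ne (hne y' hy')] at hyy
      exact h.injOn hy hy' hyy

/-- Removing a vertex `y` whose neighbours in `B` are all equal to `u` keeps the other vertices of
`B` linked. -/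
theorem Linked.diff_leaf {B : Set α} {y u a c : α} (hleaf : ∀ v ∈ B, G.Adj y v → v = u)
    (h : Linked G B a c) (ha : a ≠ y) :
    (c ≠ y → Linked G (B \ {y}) a c) ∧ (c = y → Linked G (B \ {y}) a u) := by
  induction h with
  | refl => exact ⟨fun _ => .refl, fun h => absurd h ha⟩
  | @tail c c' _ h ih =>
    obtain ⟨hc, hc', hadj⟩ := h
    by_cases hcy : c = y
    · have hu := hleaf c' hc' (hcy ▸ hadj)
      exact ⟨fun _ => hu ▸ ih.2 hcy, fun _ => ih.2 hcy⟩
    · refine ⟨fun hcy' => (ih.1 hcy).trans (.single ⟨hc, hcy⟩ ⟨hc', hcy'⟩ hadj), fun hcy' => ?_⟩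
      rw [← hleaf c hc (hcy' ▸ hadj.symm)]
      exact ih.1 hcy

/-- A vertex `y` with only one neighbour `u` in the branch sets, where `u` lies in the branch set
of `y`, can be removed. -/
theorem IsCliqueModel.diff_leaf {B : Fin t → Set α} (h : IsCliqueModel G B) {i : Fin t} {y u : α}
    (hy : y ∈ B i) (hu : u ∈ B i) (huy : u ≠ y) (hleaf : ∀ j, ∀ v ∈ B j, G.Adj y v → v = u) :
    IsCliqueModel G fun j => B j \ {y} where
  subset j := Set.sdiff_subset.trans (h.subset j)
  nonempty j := by
    by_cases hji : j = i
    · exact ⟨u, hji ▸ hu, huy⟩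
    · obtain ⟨x, hx⟩ := h.nonempty j
      refine ⟨x, hx, ?_⟩
      rintro rfl
      exact hji (h.eq_of_mem _ _ _ hx hy)
  linked j a ha c hc := ((h.linked j a ha.1 c hc.1).diff_leaf (hleaf j) ha.2).1 hc.2
  eq_of_mem j k x hj hk := h.eq_of_mem j k x hj.1 hk.1
  adj j k hjk := by
    have key : ∀ j k, j ≠ k → y ∈ B j → ∀ z ∈ B k, ¬ G.Adj y z := by
      intro j k hjk hj z hz hyz
      have := hleaf k z hz hyz
      rw [this] at hz
      exact hjk ((h.eq_of_mem _ _ _ hj hy).trans (h.eq_of_mem _ _ _ hu hz))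
    obtain ⟨x, hx, z, hz, hxz⟩ := h.adj j k hjk
    refine ⟨x, ⟨hx, ?_⟩, z, ⟨hz, ?_⟩, hxz⟩
    · rintro rfl
      exact key j k hjk.ne hx z hz hxz
    · rintro rfl
      exact key k j hjk.ne' hz x hx hxz.symm

/-! ### Lifting complete minors along an assignment -/

/-- In a `K_t`-minor with `t ≥ 3` and with as few vertices as possible, every vertex has two edges
within the union of the branch sets, so that this union has an out-edge assignment. -/
theorem IsCliqueModel.exists_isOutAssignment [G.Loopless] {B₀ : Fin t → Set α}
    (h₀ : IsCliqueModel G B₀) (hV : V(G).Finite) (ht : 3 ≤ t) :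
    ∃ (B : Fin t → Set α) (out : α → β) (nxt : α → α), IsCliqueModel G B ∧
      IsOutAssignment G (⋃ i, B i) out nxt := by
  obtain ⟨B, hB, hmin⟩ := (measure fun B : Fin t → Set α => (⋃ i, B i).ncard).wf.has_min
    {B | IsCliqueModel G B} ⟨B₀, h₀⟩
  have hB : IsCliqueModel G B := hB
  obtain ⟨out, nxt, h⟩ := LinkGraphs.exists_isOutAssignment (G := G) (W := ⋃ i, B i) (by
      obtain ⟨x, hx⟩ := hB.nonempty ⟨0, by omega⟩
      exact ⟨x, Set.mem_iUnion.2 ⟨_, hx⟩⟩) (by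
    intro y hy
    obtain ⟨i, hi⟩ := Set.mem_iUnion.1 hy
    by_cases hone : ∃ y' ∈ B i, y' ≠ y
    · obtain ⟨y', hy', hne⟩ := hone
      obtain h | ⟨u, ⟨-, hu, e, he⟩, -⟩ :=
        Relation.ReflTransGen.cases_head (hB.linked i y hi y' hy')
      · exact absurd h.symm hne
      by_contra! hcon
      have hleaf : ∀ j, ∀ v ∈ B j, G.Adj y v → v = u := by
        rintro j v hv ⟨f, hf⟩
        by_contra hvu
        have hfe : e ≠ f := by
          rintro rfl
          exact hvu (hf.right_unique he)
        exact hcon e f hfe ⟨u, Set.mem_iUnion.2 ⟨i, hu⟩, he⟩ v (Set.mem_iUnion.2 ⟨j, hv⟩) hf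
      refine hmin _ (hB.diff_leaf hi hu he.ne.symm hleaf) ?_
      change (⋃ j, B j \ {y}).ncard < (⋃ j, B j).ncard
      rw [← Set.iUnion_sdiff]
      exact Set.ncard_sdiff_singleton_lt_of_mem hy
        (hV.subset (Set.iUnion_subset hB.subset))
    · push Not at hone
      -- The other branch sets provide edges at `y` with different ends.
      have hex : ∀ j, j ≠ i → ∃ z ∈ B j, G.Adj y z := by
        intro j hj
        obtain ⟨x, hx, z, hz, hxz⟩ := hB.adj_of_ne hj.symm
        exact ⟨z, hz, hone x hx ▸ hxz⟩
      obtain ⟨j, k, hj, hk, hjk⟩ : ∃ j k, j ≠ i ∧ k ≠ i ∧ j ≠ k := by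
        have h2 : 1 < (Finset.univ.erase i).card := by
          rw [Finset.card_erase_of_mem (Finset.mem_univ i), Finset.card_univ, Fintype.card_fin]
          omega
        obtain ⟨j, hj, k, hk, hjk⟩ := Finset.one_lt_card.1 h2
        exact ⟨j, k, Finset.ne_of_mem_erase hj, Finset.ne_of_mem_erase hk, hjk⟩
      obtain ⟨z, hz, e, he⟩ := hex j hj
      obtain ⟨z', hz', f, hf⟩ := hex k hk
      refine ⟨e, f, ?_, ⟨z, Set.mem_iUnion.2 ⟨j, hz⟩, he⟩, z', Set.mem_iUnion.2 ⟨k, hz'⟩, hf⟩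
      rintro rfl
      rw [hf.right_unique he] at hz'
      exact hjk (hB.eq_of_mem _ _ _ hz hz'))
  exact ⟨B, out, nxt, hB, h⟩

/-- A complete minor of `G` whose branch sets lie in the domain of an out-edge assignment yields one
of the link graph. For each vertex `y` there is the link from `y` along the assignment. An assigned
edge makes the links of its ends adjacent, and an unassigned edge from `x` to `y` yields a path
between the links of its ends. The inner vertices of this path are links whose only unassigned
edge is the given one, so that paths of different edges are disjoint. -/
theorem IsOutAssignment.exists_isCliqueModel [G.Loopless] (h : IsOutAssignment G W out nxt)
    (hℓ : 1 ≤ ℓ) {B : Fin t → Set α} (hB : IsCliqueModel G B) (hBW : ∀ i, B i ⊆ W) :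
    ∃ C : Fin t → Set (UnorientedSeq α β ℓ), IsCliqueModel (linkGraph G ℓ) C := by
  let A : α → UnorientedSeq α β ℓ := fun y => (outRay out nxt y).link ℓ
  -- The path from `k = ℓ`, where it is at `A x`, to `k = 0`, where it is adjacent to `A y`.
  let D : α → β → α → ℕ → UnorientedSeq α β ℓ :=
    fun x e y k => (outRay out nxt x).bend ((outRay out nxt y).cons x e) ℓ k
  -- The inner vertices of the path of an unassigned edge go to the end in the branch set of smaller
  -- index.
  let C : Fin t → Set (UnorientedSeq α β ℓ) := fun i => {L | (∃ y ∈ B i, A y = L) ∨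
    ∃ x ∈ B i, ∃ j ≥ i, ∃ y ∈ B j, ∃ e, e ∉ out '' W ∧ G.IsLink e x y ∧ ∃ k < ℓ, D x e y k = L}
  have hAC : ∀ i, ∀ y ∈ B i, A y ∈ C i := fun i y hy => Or.inl ⟨y, hy, rfl⟩
  have hne : ∀ {x e}, x ∈ W → e ∉ out '' W → (outRay out nxt x).edge 0 ≠ e :=
    fun hx he hc => he (hc ▸ h.edge_mem hx 0)
  have hDadj : ∀ {x e y}, x ∈ W → y ∈ W → e ∉ out '' W → G.IsLink e x y → ∀ k,
      (linkGraph G ℓ).Adj (D x e y k) (D x e y (k + 1)) := fun hx hy he hxy k =>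
    (h.isRay hx).adj_bend (h.isRay_cons hy hxy he) rfl (hne hx he) ℓ k
  have hDA : ∀ {x e y}, x ∈ W → y ∈ W → e ∉ out '' W → G.IsLink e x y →
      (linkGraph G ℓ).Adj (D x e y 0) (A y) := fun {x e y} hx hy he hxy => by
    have := (h.isRay_cons hy hxy he).adj_tail ℓ
    rw [← Ray.bend_zero (R := outRay out nxt x) (S := (outRay out nxt y).cons x e) rfl] at this
    exact this
  have hDlink : ∀ {i x j y e}, x ∈ B i → i ≤ j → y ∈ B j → e ∉ out '' W → G.IsLink e x y →
      ∀ k ≤ ℓ, Linked (linkGraph G ℓ) (C i) (A x) (D x e y k) := by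
    intro i x j y e hx hij hy he hxy k hk
    have hmem : ∀ k ≤ ℓ, D x e y k ∈ C i := by
      intro k hk
      rcases hk.lt_or_eq with hk | rfl
      · exact Or.inr ⟨x, hx, j, hij, y, hy, e, he, hxy, k, hk, rfl⟩
      · exact Or.inl ⟨x, hx, (Ray.bend_self _ _ _).symm⟩
    have key : ∀ k ≤ ℓ, Linked (linkGraph G ℓ) (C i) (D x e y 0) (D x e y k) := fun k hk =>
      Linked.of_seq (D x e y) ℓ hmem
        (fun k _ => hDadj (hBW _ hx) (hBW _ hy) he hxy k) hk
    have hend := key ℓ le_rfl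
    rw [show D x e y ℓ = A x from Ray.bend_self _ _ _] at hend
    exact hend.symm.trans (key k hk)
  have hDedge : ∀ {x e y k}, x ∈ W → y ∈ W → e ∉ out '' W → k < ℓ →
      ∀ f ∉ out '' W, f ∈ linkEdges (D x e y k) ↔ f = e := by
    intro x e y k hx hy he hk f hf
    rw [mem_linkEdges_bend hk.le]
    constructor
    · rintro (⟨m, -, rfl⟩ | ⟨m, -, rfl⟩)
      · exact absurd (h.edge_mem hx m) hf
      · cases m with
        | zero => rfl
        | succ m => exact absurd (h.edge_mem hy m) hf
    · rintro rfl
      exact Or.inr ⟨0, by omega, rfl⟩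
  have hAedge : ∀ {y}, y ∈ W → ∀ f ∉ out '' W, f ∉ linkEdges (A y) := by
    intro y hy f hf hc
    obtain ⟨m, -, rfl⟩ := mem_linkEdges_link.1 hc
    exact hf (h.edge_mem hy m)
  have hstep : ∀ {i u v}, u ∈ B i → v ∈ B i → G.Adj u v →
      Linked (linkGraph G ℓ) (C i) (A u) (A v) := by
    rintro i u v hu hv ⟨e, he⟩
    have hassigned : ∀ w ∈ W, ∀ {u v}, u ∈ B i → v ∈ B i → u = w → v = nxt w →
        Linked (linkGraph G ℓ) (C i) (A u) (A v) := by
      rintro w hw u v hu hv rfl rfl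
      exact .single (hAC _ _ hu) (hAC _ _ hv) (h.link_adj hw ℓ)
    by_cases hout : e ∈ out '' W
    · obtain ⟨w, hw, rfl⟩ := hout
      rcases he.eq_and_eq_or_eq_and_eq (h.isLink w hw) with ⟨h1, h2⟩ | ⟨h1, h2⟩
      · exact hassigned w hw hu hv h1 h2
      · exact (hassigned w hw hv hu h2 h1).symm
    · refine (hDlink hu le_rfl hv hout he 0 (Nat.zero_le _)).trans (.single ?_ (hAC _ _ hv)
        (hDA (hBW _ hu) (hBW _ hv) hout he))
      exact Or.inr ⟨u, hu, i, le_rfl, v, hv, e, hout, he, 0, hℓ, rfl⟩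
  have hAA : ∀ {i u v}, u ∈ B i → v ∈ B i → Linked (linkGraph G ℓ) (C i) (A u) (A v) := by
    intro i u v hu hv
    have hl := hB.linked i u hu v hv
    clear hv
    induction hl with
    | refl => exact .refl
    | tail _ h' ih => exact ih.trans (hstep h'.1 h'.2.1 h'.2.2)
  have hhub : ∀ i, ∀ L ∈ C i, ∃ x ∈ B i, Linked (linkGraph G ℓ) (C i) (A x) L := by
    rintro i L (⟨y, hy, rfl⟩ | ⟨x, hx, j, hij, y, hy, e, he, hxy, k, hk, rfl⟩)
    · exact ⟨y, hy, .refl⟩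
    · exact ⟨x, hx, hDlink hx hij hy he hxy k hk.le⟩
  refine ⟨C, ?_, ?_, ?_, ?_, ?_⟩
  · rintro i L (⟨y, hy, rfl⟩ | ⟨x, hx, j, hij, y, hy, e, he, hxy, k, hk, rfl⟩)
    · exact (h.isRay (hBW _ hy)).link_mem ℓ
    · exact (h.isRay (hBW _ hx)).bend_mem (h.isRay_cons (hBW _ hy) hxy he) rfl
        (hne (hBW _ hx) he) ℓ k
  · intro i
    obtain ⟨x, hx⟩ := hB.nonempty i
    exact ⟨A x, hAC i x hx⟩
  · intro i L hL L' hL'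
    obtain ⟨x, hx, hxL⟩ := hhub i L hL
    obtain ⟨y, hy, hyL⟩ := hhub i L' hL'
    exact (hxL.symm.trans (hAA hx hy)).trans hyL
  · rintro i i' L (⟨y, hy, rfl⟩ | ⟨x, hx, j, hij, y, hy, e, he, hxy, k, hk, rfl⟩)
      (⟨y', hy', hL⟩ | ⟨x', hx', j', hij', y', hy', e', he', hxy', k', hk', hL⟩)
    · have := h.link_injOn hℓ (hBW _ hy') (hBW _ hy) hL
      exact hB.eq_of_mem i i' y hy (this ▸ hy')
    · exact absurd (hL ▸ (hDedge (hBW _ hx') (hBW _ hy') he' hk' e' he').2 rfl)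
        (hAedge (hBW _ hy) e' he')
    · exact absurd (hL ▸ (hDedge (hBW _ hx) (hBW _ hy) he hk e he).2 rfl)
        (hAedge (hBW _ hy') e he)
    · have hee := (hDedge (hBW _ hx') (hBW _ hy') he' hk' e he).1
        (hL ▸ (hDedge (hBW _ hx) (hBW _ hy) he hk e he).2 rfl)
      subst hee
      rcases hxy.eq_and_eq_or_eq_and_eq hxy' with ⟨rfl, rfl⟩ | ⟨rfl, rfl⟩
      · exact hB.eq_of_mem _ _ _ hx hx'
      · have h1 := hB.eq_of_mem _ _ _ hx hy'
        have h2 := hB.eq_of_mem _ _ _ hy hx'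
        subst h1 h2
        exact le_antisymm hij hij'
  · intro i j hij
    obtain ⟨x, hx, y, hy, e, he⟩ := hB.adj i j hij
    by_cases hout : e ∈ out '' W
    · refine ⟨A x, hAC _ _ hx, A y, hAC _ _ hy, ?_⟩
      obtain ⟨w, hw, rfl⟩ := hout
      rcases he.eq_and_eq_or_eq_and_eq (h.isLink w hw) with ⟨rfl, rfl⟩ | ⟨rfl, rfl⟩
      · exact h.link_adj hw ℓ
      · exact (h.link_adj hw ℓ).symm
    · exact ⟨_, Or.inr ⟨x, hx, j, hij.le, y, hy, e, hout, he, 0, hℓ, rfl⟩, A y, hAC _ _ hy,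
        hDA (hBW _ hx) (hBW _ hy) hout he⟩

end

section

variable {α β : Type*} {ℓ d : ℕ} {G : Graph α β} {W : Set α} {out : α → β} {nxt : α → α}

/-- The edges of `G` between `y` and a vertex of `W`. -/
def edgesInto (G : Graph α β) (y : α) (W : Set α) : Set β := {e | ∃ z ∈ W, G.IsLink e y z}

theorem exists_injective_of_le_encard {s : Set β} (h : (d : ℕ∞) ≤ s.encard) :
    ∃ e : Fin d → β, Function.Injective e ∧ ∀ i, e i ∈ s := by
  obtain ⟨t, hts, ht⟩ := Set.exists_subset_encard_eq h
  have hfin : t.Finite := Set.finite_of_encard_eq_coe ht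
  have hcard : hfin.toFinset.card = d := by
    rw [hfin.encard_eq_coe_toFinset_card] at ht
    exact_mod_cast ht
  refine ⟨fun i => (hfin.toFinset.equivFinOfCardEq hcard).symm i, ?_, fun i => hts ?_⟩
  · exact Subtype.val_injective.comp (Equiv.injective _)
  · exact hfin.mem_toFinset.1 ((hfin.toFinset.equivFinOfCardEq hcard).symm i).2

/-! ### Complete minors from rays with a common first vertex -/

/-- Rays `P 0, …, P (d - 1)` with a common first vertex, such that the first edge of each ray other
than `P 0` lies on no other ray, yield a `K_d`-minor of the link graph. The links along `P j` and `P i`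
for `j < i` are joined by shunting through the common vertex. The links met before the one along `P j`
belong to the branch set of `P i`; they contain the first edge of `P i` but not that of any `P i'` with
`i' > i`, so the branch sets are disjoint. The last part of the conclusion serves to recognize links
outside the branch sets. -/
theorem exists_isCliqueModel_of_rays (hℓ : 1 ≤ ℓ) (P : Fin d → Ray α β) (v : α)
    (hP : ∀ i, IsRay G (P i)) (h0 : ∀ i, (P i).vert 0 = v)
    (hsep : ∀ i j : Fin d, i ≠ j → 0 < (i : ℕ) → ∀ m, (P j).edge m ≠ (P i).edge 0) :
    ∃ C : Fin d → Set (UnorientedSeq α β ℓ), IsCliqueModel (linkGraph G ℓ) C ∧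
      (∀ i, (P i).link ℓ ∈ C i) ∧
      ∀ i, ∀ L ∈ C i, (0 < (i : ℕ) → (P i).edge 0 ∈ linkEdges L) ∧
        ((i : ℕ) = 0 → L = (P i).link ℓ) := by
  have hst : ∀ {i j}, j < i → (P j).vert 0 = (P i).vert 0 := fun _ => (h0 _).trans (h0 _).symm
  have hne : ∀ {i j : Fin d}, j < i → (P j).edge 0 ≠ (P i).edge 0 := fun {i j} hij =>
    hsep i j (ne_of_gt hij) (by omega) 0
  let C : Fin d → Set (UnorientedSeq α β ℓ) := fun i => {L | (P i).link ℓ = L ∨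
    ∃ j < i, ∃ k < ℓ, (P j).bend (P i) ℓ k = L}
  have hbend : ∀ {i j : Fin d}, j < i → ∀ k < ℓ, (P j).bend (P i) ℓ k ∈ C i :=
    fun hij k hk => Or.inr ⟨_, hij, k, hk, rfl⟩
  have hown : ∀ i, ∀ L ∈ C i, 0 < (i : ℕ) → (P i).edge 0 ∈ linkEdges L := by
    rintro i L (rfl | ⟨j, hj, k, hk, rfl⟩) -
    · exact mem_linkEdges_link.2 ⟨0, hℓ, rfl⟩
    · exact (mem_linkEdges_bend hk.le).2 (Or.inr ⟨0, by omega, rfl⟩)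
  have hother : ∀ i, ∀ L ∈ C i, ∀ i' > i, (P i').edge 0 ∉ linkEdges L := by
    rintro i L (rfl | ⟨j, hj, k, hk, rfl⟩) i' hi' hc
    · obtain ⟨m, -, hm⟩ := mem_linkEdges_link.1 hc
      exact hsep i' i (ne_of_gt hi') (by omega) m hm
    · rcases (mem_linkEdges_bend hk.le).1 hc with ⟨m, -, hm⟩ | ⟨m, -, hm⟩
      · exact hsep i' j (ne_of_gt (hj.trans hi')) (by omega) m hm
      · exact hsep i' i (ne_of_gt hi') (by omega) m hm
  have hhub : ∀ i, ∀ L ∈ C i, Linked (linkGraph G ℓ) (C i) ((P i).link ℓ) L := by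
    rintro i L (rfl | ⟨j, hj, k, hk, rfl⟩)
    · exact .refl
    · have := Linked.of_seq (G := linkGraph G ℓ) (B := C i) (fun k => (P j).bend (P i) ℓ k) k
        (fun m hm => hbend hj m (by omega))
        (fun m _ => (hP j).adj_bend (hP i) (hst hj) (hne hj) ℓ m) le_rfl
      simp only [Ray.bend_zero (hst hj)] at this
      exact this
  refine ⟨C, ⟨?_, ?_, ?_, ?_, ?_⟩, fun i => Or.inl rfl, fun i L hL => ⟨hown i L hL, ?_⟩⟩
  · rintro i L (rfl | ⟨j, hj, k, hk, rfl⟩)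
    · exact (hP i).link_mem ℓ
    · exact (hP j).bend_mem (hP i) (hst hj) (hne hj) ℓ k
  · exact fun i => ⟨_, Or.inl rfl⟩
  · exact fun i L hL L' hL' => (hhub i L hL).symm.trans (hhub i L' hL')
  · intro i j L hi hj
    rcases lt_trichotomy i j with hij | hij | hij
    · exact absurd (hown j L hj (by omega)) (hother i L hi j hij)
    · exact hij
    · exact absurd (hown i L hi (by omega)) (hother j L hj i hij)
  · intro i j hij
    refine ⟨_, Or.inl rfl, _, hbend hij (ℓ - 1) (by omega), ?_⟩
    have := (hP i).adj_bend (hP j) (hst hij) (hne hij) ℓ (ℓ - 1)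
    rw [Nat.sub_add_cancel hℓ, Ray.bend_self] at this
    exact this.symm
  · rintro hi
    rcases hL with rfl | ⟨j, hj, -⟩
    · rfl
    · omega

/-! ### Vertices of high degree -/

/-- A vertex outside the domain of an out-edge assignment with `d` edges into this domain yields a
`K_d`-minor of the link graph. -/
theorem IsOutAssignment.exists_isCliqueModel_of_notMem [G.Loopless]
    (h : IsOutAssignment G W out nxt) (hℓ : 1 ≤ ℓ) {v : α} (hv : v ∉ W)
    (hd : (d : ℕ∞) ≤ (edgesInto G v W).encard) :
    ∃ C : Fin d → Set (UnorientedSeq α β ℓ), IsCliqueModel (linkGraph G ℓ) C := by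
  obtain ⟨e, he, heW⟩ := exists_injective_of_le_encard hd
  choose u hu hlink using heW
  have hout : ∀ i, e i ∉ out '' W := by
    rintro i ⟨w, hw, hwe⟩
    have := h.isLink w hw
    rw [hwe] at this
    rcases (hlink i).left_eq_or_eq this with h' | h'
    · exact hv (h' ▸ hw)
    · exact hv (h' ▸ h.nxt_mem w hw)
  obtain ⟨C, hC, -⟩ := exists_isCliqueModel_of_rays (ℓ := ℓ) hℓ
    (fun i => (outRay out nxt (u i)).cons v (e i)) v
    (fun i => h.isRay_cons (hu i) (hlink i) (hout i)) (fun _ => rfl) (by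
      rintro i j hij - m hm
      cases m with
      | zero => exact hij (he hm.symm)
      | succ m =>
        have hm' : (outRay out nxt (u j)).edge m = e i := hm
        exact hout i (hm' ▸ h.edge_mem (hu j) m))
  exact ⟨C, hC⟩

theorem exists_isOutAssignment_pair {x y : α} (hxy : x ≠ y) {e f : β} (hef : e ≠ f)
    (he : G.IsLink e x y) (hf : G.IsLink f x y) :
    ∃ out nxt, IsOutAssignment G {x, y} out nxt ∧ out x = e ∧ out y = f ∧ nxt x = y := by
  classical
  refine ⟨Function.update (fun _ => f) x e, Function.update (fun _ => x) x y, ⟨?_, ?_, ?_⟩,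
    by simp, by simp [hxy.symm], by simp⟩
  · rintro z (rfl | rfl) <;> simp [hxy.symm]
  · rintro z (rfl | rfl)
    · simpa using he
    · simpa [hxy.symm] using hf.symm
  · rintro z (rfl | rfl) z' (rfl | rfl) h
    · rfl
    · exact absurd (by simpa [hxy.symm] using h) hef
    · exact absurd (by simpa [hxy.symm] using h.symm) hef
    · rfl

theorem cons_outRay (out : α → β) (nxt : α → α) (x : α) :
    (outRay out nxt (nxt x)).cons x (out x) = outRay out nxt x := by
  rw [Ray.cons, outRay, outRay, Ray.mk.injEq]
  constructor <;> funext k <;> cases k <;> rfl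

/-- Two vertices `x` and `y` with `d` parallel edges between them yield a `K_d`-minor of the link
graph. One edge is assigned to `x` and one to `y`. The rays from `x` that cross one of the edges not
assigned to `y` and then follow the assignment yield `d - 1` branch sets, and the link from `y` along
the assignment is adjacent to all of them. -/
theorem exists_isCliqueModel_of_parallel [G.Loopless] (hℓ : 1 ≤ ℓ) {x y : α} (hxy : x ≠ y)
    (e : Fin (d + 2) → β) (he : Function.Injective e) (hlink : ∀ i, G.IsLink (e i) x y) :
    ∃ C : Fin (d + 2) → Set (UnorientedSeq α β ℓ), IsCliqueModel (linkGraph G ℓ) C := by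
  obtain ⟨out, nxt, h, hx, hy, hnxt⟩ := exists_isOutAssignment_pair hxy
    (he.ne (show (0 : Fin (d + 2)) ≠ Fin.last (d + 1) from (Fin.last_pos).ne)) (hlink _) (hlink _)
  have hxW : x ∈ ({x, y} : Set α) := Or.inl rfl
  have hyW : y ∈ ({x, y} : Set α) := Or.inr rfl
  have himage : out '' {x, y} = {e 0, e (Fin.last (d + 1))} := by
    rw [Set.image_pair, hx, hy]
  have hout : ∀ i : Fin (d + 1), 0 < (i : ℕ) → e i.castSucc ∉ out '' {x, y} := by
    intro i hi hc
    rw [himage] at hc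
    rcases hc with hc | hc
    · have := congrArg Fin.val (he hc)
      simp only [Fin.val_castSucc, Fin.val_zero] at this
      omega
    · exact (Fin.castSucc_lt_last i).ne (he hc)
  let P : Fin (d + 1) → Ray α β := fun i => (outRay out nxt y).cons x (e i.castSucc)
  have hP : ∀ i, IsRay G (P i) := fun i => (h.isRay hyW).cons (hlink _) (by
    change _ ≠ out y
    rw [hy]
    exact he.ne (Fin.castSucc_lt_last i).ne)
  have hP0 : P 0 = outRay out nxt x := by
    rw [← cons_outRay, hnxt, hx]
    rfl
  obtain ⟨C, hC, hPC, hCe⟩ := exists_isCliqueModel_of_rays (ℓ := ℓ) hℓ P x hP (fun _ => rfl) (by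
    rintro i j hij hi m hm
    cases m with
    | zero => exact hij (Fin.castSucc_injective _ (he hm.symm))
    | succ m =>
      have hm' : (outRay out nxt y).edge m = e i.castSucc := hm
      exact hout i hi (hm' ▸ h.edge_mem hyW m))
  refine ⟨_, hC.cons (x := (outRay out nxt y).link ℓ) ?_ ((h.isRay hyW).link_mem ℓ) ?_⟩
  · intro i hi
    obtain ⟨h1, h2⟩ := hCe i _ hi
    rcases Nat.eq_zero_or_pos (i : ℕ) with hi0 | hi0
    · have hi0' : i = 0 := Fin.ext hi0
      have := h2 hi0
      rw [hi0', hP0] at this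
      exact hxy (h.link_injOn hℓ hyW hxW this).symm
    · obtain ⟨m, -, hm⟩ := mem_linkEdges_link.1 (h1 hi0)
      have hm' : (outRay out nxt y).edge m = e i.castSucc := hm
      exact hout i hi0 (hm' ▸ h.edge_mem hyW m)
  · exact fun i => ⟨_, hPC i, ((hP i).adj_tail ℓ).symm⟩

/-- If every vertex of the set `W` has at least three edges into `W`, then either `W` consists
of two vertices, or some nonempty proper subset of `W` has an out-edge assignment. -/
theorem exists_pair_or_isOutAssignment [G.Loopless] (hne : W.Nonempty)
    (hdeg : ∀ y ∈ W, 3 ≤ (edgesInto G y W).encard) :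
    (∃ x y, x ≠ y ∧ W = {x, y}) ∨
      ∃ U ⊂ W, U.Nonempty ∧ ∃ out nxt, IsOutAssignment G U out nxt := by
  by_cases hpar : ∃ x ∈ W, ∃ y ∈ W, ∃ e f, e ≠ f ∧ G.IsLink e x y ∧ G.IsLink f x y
  · obtain ⟨x, hx, y, hy, e, f, hef, he, hf⟩ := hpar
    by_cases hW : W = {x, y}
    · exact Or.inl ⟨x, y, he.ne, hW⟩
    · obtain ⟨out, nxt, h, -⟩ := exists_isOutAssignment_pair he.ne hef he hf
      refine Or.inr ⟨{x, y}, ⟨?_, fun hc => hW (hc.antisymm ?_)⟩, ⟨x, Or.inl rfl⟩, out, nxt, h⟩ <;>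
      · rintro z (rfl | rfl) <;> assumption
  · push Not at hpar
    obtain ⟨x, hx⟩ := hne
    obtain ⟨e, -, hex⟩ := exists_injective_of_le_encard (d := 3) (hdeg x hx)
    obtain ⟨z, hz, hxz⟩ := hex 0
    have hU : (W \ {x}).Nonempty := ⟨z, hz, hxz.ne.symm⟩
    refine Or.inr ⟨W \ {x}, ⟨Set.sdiff_subset, fun hc => (hc hx).2 rfl⟩, hU,
      exists_isOutAssignment hU ?_⟩
    rintro y ⟨hy, hyx⟩
    obtain ⟨e, he, hey⟩ := exists_injective_of_le_encard (d := 3) (hdeg y hy)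
    choose u hu hlink using hey
    have hdisj : ∀ i j, i ≠ j → u i = x → u j ∈ W \ {x} := by
      refine fun i j hij hi => ⟨hu j, fun hj => ?_⟩
      have hj : u j = x := hj
      exact hpar y hy x hx (e i) (e j) (he.ne hij) (hi ▸ hlink i) (hj ▸ hlink j)
    -- Without parallel edges, at most one of three edges at `y` leads to `x`.
    by_cases h0 : u 0 = x
    · exact ⟨e 1, e 2, he.ne (by decide), ⟨u 1, hdisj 0 1 (by decide) h0, hlink 1⟩,
        u 2, hdisj 0 2 (by decide) h0, hlink 2⟩
    · by_cases h1 : u 1 = x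
      · exact ⟨e 0, e 2, he.ne (by decide), ⟨u 0, ⟨hu 0, h0⟩, hlink 0⟩,
          u 2, hdisj 1 2 (by decide) h1, hlink 2⟩
      · exact ⟨e 0, e 1, he.ne (by decide), ⟨u 0, ⟨hu 0, h0⟩, hlink 0⟩, u 1, ⟨hu 1, h1⟩, hlink 1⟩

/-- In a nonempty vertex set `W` as small as possible such that every vertex of `W` has at least `d`
edges into `W`, a maximal proper subset with an out-edge assignment leaves out a single vertex. -/
theorem exists_isCliqueModel_of_le_degree [G.Loopless] (hℓ : 1 ≤ ℓ) (hd : 3 ≤ d) {W₀ : Set α}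
    (hfin₀ : W₀.Finite) (hne₀ : W₀.Nonempty)
    (hdeg₀ : ∀ y ∈ W₀, (d : ℕ∞) ≤ (edgesInto G y W₀).encard) :
    ∃ C : Fin d → Set (UnorientedSeq α β ℓ), IsCliqueModel (linkGraph G ℓ) C := by
  obtain ⟨W, ⟨hfin, hne, hdeg⟩, hmin⟩ := (measure fun W : Set α => W.ncard).wf.has_min
    {W | W.Finite ∧ W.Nonempty ∧ ∀ y ∈ W, (d : ℕ∞) ≤ (edgesInto G y W).encard}
    ⟨W₀, hfin₀, hne₀, hdeg₀⟩
  rcases exists_pair_or_isOutAssignment hne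
    (fun y hy => le_trans (by exact_mod_cast hd) (hdeg y hy)) with ⟨x, y, hxy, rfl⟩ | hU
  · obtain ⟨d, rfl⟩ := Nat.exists_eq_add_of_le' (show 2 ≤ d by omega)
    obtain ⟨e, he, hex⟩ := exists_injective_of_le_encard (hdeg x (Or.inl rfl))
    refine exists_isCliqueModel_of_parallel hℓ hxy e he fun i => ?_
    obtain ⟨z, rfl | rfl, hz⟩ := hex i
    · exact absurd rfl hz.ne
    · exact hz
  · obtain ⟨U, ⟨hUW, hUne, out, nxt, h⟩, hmax⟩ :=
      (hfin.finite_subsets.subset fun U (hU : U ⊂ W ∧ U.Nonempty ∧ _) => hU.1.1).exists_maximal hU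
    by_cases hz : ∃ z ∈ W, z ∉ U ∧ ∃ u ∈ U, ∃ e, G.IsLink e z u
    · obtain ⟨z, hz, hzU, u, hu, e, he⟩ := hz
      have hins : W = insert z U := by
        by_contra hc
        have hsub : insert z U ⊆ W := Set.insert_subset hz hUW.1
        exact hzU (hmax ⟨hsub.ssubset_of_ne (Ne.symm hc), Set.insert_nonempty _ _,
          h.exists_insert hzU hu he⟩ (Set.subset_insert z U) (Set.mem_insert z U))
      refine h.exists_isCliqueModel_of_notMem hℓ hzU ((hdeg z hz).trans (Set.encard_le_encard ?_))
      rintro f ⟨w, hw, hf⟩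
      rw [hins] at hw
      rcases hw with rfl | hw
      · exact absurd rfl hf.ne
      · exact ⟨w, hw, hf⟩
    · push Not at hz
      refine absurd (Set.ncard_lt_ncard hUW hfin) (hmin U ⟨hfin.subset hUW.1, hUne, fun y hy =>
        (hdeg y (hUW.1 hy)).trans (Set.encard_le_encard ?_)⟩)
      rintro f ⟨w, hw, hf⟩
      by_contra hc
      exact hz w hw (fun hwU => hc ⟨w, hwU, hf⟩) y hy f hf.symm

/-! ### Loops of link graphs -/

/-- The two segments of length `ℓ` of an arc of length `ℓ + 1` are not the same link. If they agree
up to reversal, the two middle edges or the two ends of the middle edge of the segments agree. -/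
theorem linkGraph_loopless [G.Loopless] (hℓ : 1 ≤ ℓ) : (linkGraph G ℓ).Loopless where
  not_isLoopAt Q L hQ := by
    obtain ⟨A, hA, -, hi, ht⟩ := hQ
    rcases unorient_eq_iff.1 (hi.trans ht.symm) with h | h
    · have := congrArg (fun B => B.edge ⟨0, hℓ⟩) h
      exact hA.edge_ne ⟨0, by omega⟩ ⟨1, by omega⟩ rfl this.symm
    · rcases Nat.even_or_odd' ℓ with ⟨s, hs | hs⟩
      · have hv := congrArg (fun B => B.vert ⟨s, by omega⟩) h
        have hl := hA.isLink ⟨s, by omega⟩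
        refine hl.ne (Eq.trans ?_ hv.symm)
        simp only [AltSeq.reverse, AltSeq.init]
        congr 1
        ext
        simp only [Fin.val_castSucc, Fin.val_rev]
        omega
      · have he := congrArg (fun B => B.edge ⟨s, by omega⟩) h
        refine hA.edge_ne ⟨s, by omega⟩ ⟨s + 1, by omega⟩ rfl (Eq.trans ?_ he.symm)
        simp only [AltSeq.reverse, AltSeq.init]
        congr 1
        ext
        simp only [Fin.val_castSucc, Fin.val_rev]
        omega

theorem two_le_hadwigerNumber [G.Loopless] (h : E(G).Nonempty) : 2 ≤ hadwigerNumber G := by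
  obtain ⟨e, he⟩ := h
  obtain ⟨x, y, hxy⟩ := Graph.exists_isLink_of_mem_edgeSet he
  have hempty : IsCliqueModel G (Fin.elim0 : Fin 0 → Set α) :=
    ⟨fun i => i.elim0, fun i => i.elim0, fun i => i.elim0, fun i => i.elim0, fun i => i.elim0⟩
  have hone := hempty.cons (x := x) (fun i => i.elim0) hxy.left_mem fun i => i.elim0
  have htwo := hone.cons (x := y) (by simpa [Fin.forall_fin_one] using hxy.ne.symm) hxy.right_mem
    (by simpa [Fin.forall_fin_one] using hxy.symm.adj)
  exact htwo.le_hadwigerNumber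

end

end LinkGraphs

theorem mainTheorem3 {α β : Type*} (G : Graph α β) (hV : V(G).Finite) (hE : E(G).Finite)
    (hG : G.Loopless) (ℓ : ℕ) (hℓ : 1 ≤ ℓ)
    (hedge : E(LinkGraphs.linkGraph G ℓ).Nonempty) :
    max (LinkGraphs.hadwigerNumber G) (LinkGraphs.degeneracy G) ≤
      LinkGraphs.hadwigerNumber (LinkGraphs.linkGraph G ℓ) := by
  have := LinkGraphs.linkGraph_loopless (G := G) hℓ
  have htwo := LinkGraphs.two_le_hadwigerNumber hedge
  refine max_le (iSup₂_le fun t ht => ?_) (iSup₂_le fun H hH => ?_)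
  · rcases lt_or_ge t 3 with h3 | h3
    · exact le_trans (by exact_mod_cast Nat.le_of_lt_succ h3) htwo
    · obtain ⟨B₀, hB₀⟩ := ht.exists_isCliqueModel
      obtain ⟨B, out, nxt, hB, h⟩ := hB₀.exists_isOutAssignment hV h3
      obtain ⟨C, hC⟩ := h.exists_isCliqueModel hℓ hB (Set.subset_iUnion B)
      exact hC.le_hadwigerNumber
  · refine ENat.forall_natCast_le_iff_le.1 fun d hd => ?_
    rcases lt_or_ge d 3 with h3 | h3
    · exact le_trans (by exact_mod_cast Nat.le_of_lt_succ h3) htwo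
    · obtain ⟨C, hC⟩ := LinkGraphs.exists_isCliqueModel_of_le_degree (G := G) hℓ h3
        (hV.subset hH.1.vertexSet_mono) hH.2 (fun y hy =>
          (hd.trans (iInf₂_le y hy)).trans (Set.encard_le_encard (by
            rintro e ⟨z, hz⟩
            exact ⟨z, hz.right_mem, hz.mono hH.1⟩)))
      exact hC.le_hadwigerNumber
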